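/- Let \(\widetilde C_1,\widetilde C_2\) be the qubit amplitude-damping channels with decay parameters \(\gamma_1=0.37\) and \(\gamma_2=0.87\), where the channel with parameter \(\gamma\) is \(\rho\mapsto K_0\rho K_0^\dagger+K_1\rho K_1^\dagger\) with \(K_0=|0\rangle\langle 0|+\sqrt{1-\gamma}\,|1\rangle\langle 1|\) and \(K_1=\sqrt{\gamma}\,|0\rangle\langle 1|\). Let \(C_i=\sum_{k,l}|k\rangle\langle l|\otimes\widetilde C_i(|k\rangle\langle l|)\) be their Choi operators, on (input) \(\otimes\) (output). Let \(I_1,O_1,I_2,O_2\) be qubit spaces (input and output of slots 1 and 2), and for a set \(X\) of them write \({}_XA=\mathrm{Tr}_XA\otimes\mathbb 1^X/d_X\), where \(d_X\) is the dimension of the tensor product of the spaces in \(X\). Consider positive semidefinite operators \(W\) on \(I_1\otimes O_1\otimes I_2\otimes O_2\) with \(\mathrm{Tr}\,W=d_{O_1}d_{O_2}=4\). Such a \(W\) is - a parallel (PAR) process if \(W={}_{O_1O_2}W\); - a sequential (SEQ) process, with slot 1 before slot 2, if \(W={}_{O_2}W\) and \({}_{I_2O_2}W={}_{O_1I_2O_2}W\);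 - a separable (SEP) process if \(W=qW^{1\prec2}+(1-q)W^{2\prec1}\) for some \(0\le q\le1\), where \(W^{1\prec2}\) is a sequential process and \(W^{2\prec1}\) is a sequential process with the roles of the two slots exchanged; - a general (GEN) process if \({}_{I_1O_1}W={}_{I_1O_1O_2}W\), \({}_{I_2O_2}W={}_{O_1I_2O_2}W\) and \(W={}_{O_1}W+{}_{O_2}W-{}_{O_1O_2}W\). For \(\mathcal S\in\{\mathrm{PAR},\mathrm{SEQ},\mathrm{SEP},\mathrm{GEN}\}\), a tester of class \(\mathcal S\) is a pair \((T_1,T_2)\) of positive semidefinite operators such that \(T_1+T_2\) is a process of class \(\mathcal S\), and \[ P^{\mathcal S}=\max_{(T_1,T_2)}\ \sum_{i=1}^{2}\tfrac12\,\mathrm{Tr}\bigl(T_i\,(C_i\otimes C_i)\bigr), \] the maximum over all testers of class \(\mathcal S\), is the maximal probability of discriminating the two equiprobable channels with two copies. Then these maxima exist, \(P^{\mathrm{PAR}}<P^{\mathrm{SEQ}}<P^{\mathrm{SEP}}<P^{\mathrm{GEN}}\), and \[ \tfrac{8101}{10000}<P^{\mathrm{PAR}}<\tfrac{8102}{10000},\qquad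 \tfrac{8161}{10000}<P^{\mathrm{SEQ}}<\tfrac{8162}{10000}, \] \[ \tfrac{8166}{10000}<P^{\mathrm{SEP}}<\tfrac{81665}{100000},\qquad \tfrac{8167}{10000}<P^{\mathrm{GEN}}<\tfrac{8168}{10000}. \] -/

import Mathlib

open scoped Matrix Kronecker ComplexOrder

noncomputable section

namespace ChannelDiscrimination

/-- The linear map `ρ ↦ ∑ k, K k * ρ * (K k)ᴴ` with Kraus operators `K k`. -/
def krausMap {κ I O : Type*} [Fintype κ] [Fintype I] (K : κ → Matrix O I ℂ) :
    Matrix I I ℂ →ₗ[ℂ] Matrix O O ℂ where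
  toFun ρ := ∑ k, K k * ρ * (K k)ᴴ
  map_add' ρ σ := by
    simp [Matrix.mul_add, Matrix.add_mul, Finset.sum_add_distrib]
  map_smul' c ρ := by
    simp [Finset.smul_sum]

/-- The qubit amplitude-damping channel with decay parameter `γ ∈ [0, 1]`: its Kraus operators are
`|0⟩⟨0| + √(1 - γ) |1⟩⟨1|` and `√γ |0⟩⟨1|`. -/
def amplitudeDamping (γ : ℝ) : Matrix (Fin 2) (Fin 2) ℂ →ₗ[ℂ] Matrix (Fin 2) (Fin 2) ℂ :=
  krausMap ![!![1, 0; 0, ((√(1 - γ) : ℝ) : ℂ)], !![0, ((√γ : ℝ) : ℂ); 0, 0]]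

/-- The Choi operator `∑ i i', |i⟩⟨i'| ⊗ Φ(|i⟩⟨i'|)` of a linear map `Φ`. -/
def choi {I O : Type*} [DecidableEq I] (Φ : Matrix I I ℂ →ₗ[ℂ] Matrix O O ℂ) :
    Matrix (I × O) (I × O) ℂ :=
  Matrix.of fun a b => Φ (Matrix.single a.1 b.1 1) a.2 b.2

/-- Linear operators on the tensor product of the spaces `I₁`, `O₁`, `I₂`, `O₂`
(first slot: input `I₁`, output `O₁`; second slot: input `I₂`, output `O₂`). -/
abbrev Op (I₁ O₁ I₂ O₂ : Type*) : Type _ :=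
  Matrix ((I₁ × O₁) × (I₂ × O₂)) ((I₁ × O₁) × (I₂ × O₂)) ℂ

section TraceAndReplace

variable {I₁ O₁ I₂ O₂ : Type*}

/-- Trace-and-replace on `I₁`: trace out `I₁` and put `1 / d` on it, with `d` its dimension.
The operations on several systems are obtained by composition. -/
def replI₁ [Fintype I₁] [DecidableEq I₁] (A : Op I₁ O₁ I₂ O₂) : Op I₁ O₁ I₂ O₂ :=
  Matrix.of fun a b =>
    if a.1.1 = b.1.1 then
      (Fintype.card I₁ : ℂ)⁻¹ * ∑ x : I₁, A ((x, a.1.2), a.2) ((x, b.1.2), b.2)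
    else 0

/-- Trace-and-replace on `O₁`. -/
def replO₁ [Fintype O₁] [DecidableEq O₁] (A : Op I₁ O₁ I₂ O₂) : Op I₁ O₁ I₂ O₂ :=
  Matrix.of fun a b =>
    if a.1.2 = b.1.2 then
      (Fintype.card O₁ : ℂ)⁻¹ * ∑ x : O₁, A ((a.1.1, x), a.2) ((b.1.1, x), b.2)
    else 0

/-- Trace-and-replace on `I₂`. -/
def replI₂ [Fintype I₂] [DecidableEq I₂] (A : Op I₁ O₁ I₂ O₂) : Op I₁ O₁ I₂ O₂ :=
  Matrix.of fun a b =>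
    if a.2.1 = b.2.1 then
      (Fintype.card I₂ : ℂ)⁻¹ * ∑ x : I₂, A (a.1, (x, a.2.2)) (b.1, (x, b.2.2))
    else 0

/-- Trace-and-replace on `O₂`. -/
def replO₂ [Fintype O₂] [DecidableEq O₂] (A : Op I₁ O₁ I₂ O₂) : Op I₁ O₁ I₂ O₂ :=
  Matrix.of fun a b =>
    if a.2.2 = b.2.2 then
      (Fintype.card O₂ : ℂ)⁻¹ * ∑ x : O₂, A (a.1, (a.2.1, x)) (b.1, (b.2.1, x))
    else 0

end TraceAndReplace

section Processes

variable {I₁ O₁ I₂ O₂ : Type*} [Fintype I₁] [Fintype O₁] [Fintype I₂] [Fintype O₂]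
  [DecidableEq I₁] [DecidableEq O₁] [DecidableEq I₂] [DecidableEq O₂]

/-- The normalization common to all classes of processes: a positive semidefinite operator of
trace `d_{O₁} d_{O₂}`. -/
def IsNormalized (W : Op I₁ O₁ I₂ O₂) : Prop :=
  W.PosSemidef ∧ W.trace = (Fintype.card O₁ : ℂ) * (Fintype.card O₂ : ℂ)

/-- Parallel processes. -/
def IsParallelProcess (W : Op I₁ O₁ I₂ O₂) : Prop :=
  IsNormalized W ∧ W = replO₁ (replO₂ W)

/-- Sequential processes in which slot `1` comes before slot `2`. -/
def IsSequentialProcess (W : Op I₁ O₁ I₂ O₂) : Prop :=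
  IsNormalized W ∧ W = replO₂ W ∧ replI₂ (replO₂ W) = replO₁ (replI₂ (replO₂ W))

/-- Sequential processes in which slot `2` comes before slot `1`. -/
def IsSequentialProcess' (W : Op I₁ O₁ I₂ O₂) : Prop :=
  IsNormalized W ∧ W = replO₁ W ∧ replI₁ (replO₁ W) = replO₂ (replI₁ (replO₁ W))

/-- Separable processes: convex mixtures of sequential processes of the two orders. -/
def IsSeparableProcess (W : Op I₁ O₁ I₂ O₂) : Prop :=
  IsNormalized W ∧ ∃ (q : ℝ) (W₁₂ W₂₁ : Op I₁ O₁ I₂ O₂), 0 ≤ q ∧ q ≤ 1 ∧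
    IsSequentialProcess W₁₂ ∧ IsSequentialProcess' W₂₁ ∧
    W = (q : ℂ) • W₁₂ + ((1 - q : ℝ) : ℂ) • W₂₁

/-- General processes. -/
def IsGeneralProcess (W : Op I₁ O₁ I₂ O₂) : Prop :=
  IsNormalized W ∧
    replI₁ (replO₁ W) = replI₁ (replO₁ (replO₂ W)) ∧
    replI₂ (replO₂ W) = replO₁ (replI₂ (replO₂ W)) ∧
    W = replO₁ W + replO₂ W - replO₁ (replO₂ W)

/-- The four classes of strategies. -/
inductive Strategy
  | par
  | seq
  | sep
  | gen

/-- The processes of a given class. -/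
def IsProcess (S : Strategy) (W : Op I₁ O₁ I₂ O₂) : Prop :=
  match S with
  | .par => IsParallelProcess W
  | .seq => IsSequentialProcess W
  | .sep => IsSeparableProcess W
  | .gen => IsGeneralProcess W

/-- Two-copy testers of a given class. -/
def IsTester {ι : Type*} [Fintype ι] (S : Strategy) (T : ι → Op I₁ O₁ I₂ O₂) : Prop :=
  (∀ i, (T i).PosSemidef) ∧ IsProcess S (∑ i, T i)

end Processes

section Success

variable {ι I O : Type*} [Fintype ι] [Fintype I] [Fintype O] [DecidableEq I] [DecidableEq O]

/-- The probability `∑ i, p i * Tr (T i * (C i ⊗ C i))` of guessing the channel correctly with the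
tester `T`, where channel `i` has probability `p i` and Choi operator `C i`. (Each trace is real for
positive semidefinite operators; `re` only moves it from `ℂ` to `ℝ`.) -/
def successProbability (p : ι → ℝ) (Φ : ι → Matrix I I ℂ →ₗ[ℂ] Matrix O O ℂ)
    (T : ι → Op I O I O) : ℝ :=
  ∑ i, p i * (T i * (choi (Φ i) ⊗ₖ choi (Φ i))).trace.re

/-- The success probabilities that two-copy testers of class `S` reach. -/
def successProbabilities (S : Strategy) (p : ι → ℝ)
    (Φ : ι → Matrix I I ℂ →ₗ[ℂ] Matrix O O ℂ) : Set ℝ :=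
  {r | ∃ T : ι → Op I O I O, IsTester S T ∧ r = successProbability p Φ T}

/-- The maximal probability of success with two copies under strategy class `S`. -/
def maxSuccess (S : Strategy) (p : ι → ℝ) (Φ : ι → Matrix I I ℂ →ₗ[ℂ] Matrix O O ℂ) : ℝ :=
  sSup (successProbabilities S p Φ)

end Success

/-- The two amplitude-damping channels with decay parameters `0.37` and `0.87`. -/
def twoDampings : Fin 2 → Matrix (Fin 2) (Fin 2) ℂ →ₗ[ℂ] Matrix (Fin 2) (Fin 2) ℂ :=
  ![amplitudeDamping (37 / 100), amplitudeDamping (87 / 100)]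

/-- `P^S` for the two channels above, each with probability `1 / 2`. -/
def P (S : Strategy) : ℝ := maxSuccess S (fun _ => 1 / 2) twoDampings

end ChannelDiscrimination

end

/-! Each maximum is a semidefinite program, and it is enclosed between a rational primal point and a
rational dual point. The upper bound is weak duality: if `X` dominates `(1/2) C_i ⊗ C_i` for both
channels, every tester with sum `W` succeeds with probability at most `Tr(W X)`. For PAR, SEQ and
GEN the linear constraints say that `W` is fixed by a self-adjoint map built from trace-and-replace
operations. If that map sends `X` to `c • 1`, then `Tr(W X) = 4c` for every process of the class
(the `trace_mul` lemmas). For SEP, `sepDual` lies below two operators, each of constant value on one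
of the two orders, and mixing the orders preserves the bound. The lower bounds come from explicit
testers. The resulting four intervals are disjoint, which gives the strict hierarchy; compactness of
the tester sets gives attainment.

All certificates are taken invariant under independent phase rotations of the two slots. A 16 × 16
matrix then splits into one 4 × 4 block, four 2 × 2 blocks and four scalars, so positivity reduces
to rational minors (`MinorsPos`). Arbitrary testers need not be symmetrized, since weak duality
applies to them directly. The irrational `√(1 - γ)` enters only through an interval: the dual side
replaces `C ⊗ C` by a slightly larger rational operator (`dampingMajorant`), and the primal value is
affine in the two roots. -/

namespace ChannelDiscrimination

/-! ### Self-adjointness of trace-and-replace for the trace pairing. -/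

section TraceAdjoint

variable {I₁ O₁ I₂ O₂ : Type*} [Fintype I₁] [Fintype O₁] [Fintype I₂] [Fintype O₂]

lemma trace_replO₂_mul [DecidableEq O₂] (A B : Op I₁ O₁ I₂ O₂) :
    (replO₂ A * B).trace = (A * replO₂ B).trace := by
  simp only [Matrix.trace, Matrix.diag, Matrix.mul_apply, replO₂, Matrix.of_apply,
    Fintype.sum_prod_type, ite_mul, mul_ite, zero_mul, mul_zero, Finset.sum_ite_eq,
    Finset.sum_ite_eq', Finset.mem_univ, if_true]
  refine Finset.sum_congr rfl fun a _ => Finset.sum_congr rfl fun b _ =>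
    Finset.sum_congr rfl fun c _ => ?_
  -- Each round carries the sum over the traced index inwards past one index common to both sides;
  -- what is left is a product of two partial traces.
  iterate 3
    rw [Finset.sum_comm]; conv_rhs => rw [Finset.sum_comm]
    refine Finset.sum_congr rfl fun _ _ => ?_
  simp only [← Finset.mul_sum, ← Finset.sum_mul]
  ring

lemma trace_replO₁_mul [DecidableEq O₁] (A B : Op I₁ O₁ I₂ O₂) :
    (replO₁ A * B).trace = (A * replO₁ B).trace := by
  simp only [Matrix.trace, Matrix.diag, Matrix.mul_apply, replO₁, Matrix.of_apply,
    Fintype.sum_prod_type, ite_mul, mul_ite, zero_mul, mul_zero, Finset.sum_ite_irrel,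
    Finset.sum_const_zero, Finset.sum_ite_eq,
    Finset.sum_ite_eq', Finset.mem_univ, if_true]
  refine Finset.sum_congr rfl fun a _ => ?_
  iterate 5
    rw [Finset.sum_comm]; conv_rhs => rw [Finset.sum_comm]
    refine Finset.sum_congr rfl fun _ _ => ?_
  simp only [← Finset.mul_sum, ← Finset.sum_mul]
  ring

lemma trace_replI₂_mul [DecidableEq I₂] (A B : Op I₁ O₁ I₂ O₂) :
    (replI₂ A * B).trace = (A * replI₂ B).trace := by
  simp only [Matrix.trace, Matrix.diag, Matrix.mul_apply, replI₂, Matrix.of_apply,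
    Fintype.sum_prod_type, ite_mul, mul_ite, zero_mul, mul_zero, Finset.sum_ite_irrel,
    Finset.sum_const_zero, Finset.sum_ite_eq,
    Finset.sum_ite_eq', Finset.mem_univ, if_true]
  refine Finset.sum_congr rfl fun a _ => Finset.sum_congr rfl fun b _ => ?_
  iterate 4
    rw [Finset.sum_comm]; conv_rhs => rw [Finset.sum_comm]
    refine Finset.sum_congr rfl fun _ _ => ?_
  simp only [← Finset.mul_sum, ← Finset.sum_mul]
  ring

lemma trace_replI₁_mul [DecidableEq I₁] (A B : Op I₁ O₁ I₂ O₂) :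
    (replI₁ A * B).trace = (A * replI₁ B).trace := by
  simp only [Matrix.trace, Matrix.diag, Matrix.mul_apply, replI₁, Matrix.of_apply,
    Fintype.sum_prod_type, ite_mul, mul_ite, zero_mul, mul_zero, Finset.sum_ite_irrel,
    Finset.sum_const_zero, Finset.sum_ite_eq,
    Finset.sum_ite_eq', Finset.mem_univ, if_true]
  iterate 6
    rw [Finset.sum_comm]; conv_rhs => rw [Finset.sum_comm]
    refine Finset.sum_congr rfl fun _ _ => ?_
  simp only [← Finset.mul_sum, ← Finset.sum_mul]
  ring

end TraceAdjoint

lemma posSemidef_map_ofReal {n : Type*} [Fintype n] {A : Matrix n n ℝ} (hA : A.PosSemidef) :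
    (A.map (fun x : ℝ => (x : ℂ))).PosSemidef := by
  classical
  open scoped MatrixOrder in
  obtain ⟨B, rfl⟩ := CStarAlgebra.nonneg_iff_eq_star_mul_self.mp hA.nonneg
  have h : (star B * B).map (fun x : ℝ => (x : ℂ)) =
      (B.map (fun x : ℝ => (x : ℂ)))ᴴ * B.map (fun x : ℝ => (x : ℂ)) := by
    ext i j
    simp [Matrix.mul_apply, Matrix.star_eq_conjTranspose]
  rw [h]
  exact Matrix.posSemidef_conjTranspose_mul_self _

/-- With `B = C* C`, cyclicity turns the trace into that of the positive semidefinite `C A C*`. -/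
lemma trace_mul_re_nonneg {n : Type*} [Fintype n] {A B : Matrix n n ℂ} (hA : A.PosSemidef)
    (hB : B.PosSemidef) : 0 ≤ (A * B).trace.re := by
  classical
  open scoped MatrixOrder in
  obtain ⟨C, rfl⟩ := CStarAlgebra.nonneg_iff_eq_star_mul_self.mp hB.nonneg
  rw [← mul_assoc, Matrix.trace_mul_comm, ← mul_assoc]
  exact (Complex.le_def.mp (hA.mul_mul_conjTranspose_same C).trace_nonneg).1

/-! ### Phase-invariant operators and their blocks. -/

/-- A real operator on `I₁ ⊗ O₁ ⊗ I₂ ⊗ O₂` that is invariant under the phase rotations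
`diag(1, e^{-iθ}) ⊗ diag(1, e^{iθ})` of each slot: its entries are the diagonal ones and the
coherences between `|00⟩` and `|11⟩` in slot `1` (`c₁`, indexed by the state of slot `2`), in
slot `2` (`c₂`, indexed by the state of slot `1`) and in both slots (`g` and `h`). -/
@[ext]
structure InvariantOp where
  diag : Fin 2 → Fin 2 → Fin 2 → Fin 2 → ℝ
  c₁ : Fin 2 → Fin 2 → ℝ
  c₂ : Fin 2 → Fin 2 → ℝ
  g : ℝ
  h : ℝ

namespace InvariantOp

instance : Add InvariantOp :=
  ⟨fun X Y => ⟨X.diag + Y.diag, X.c₁ + Y.c₁, X.c₂ + Y.c₂, X.g + Y.g, X.h + Y.h⟩⟩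

instance : Sub InvariantOp :=
  ⟨fun X Y => ⟨X.diag - Y.diag, X.c₁ - Y.c₁, X.c₂ - Y.c₂, X.g - Y.g, X.h - Y.h⟩⟩

noncomputable instance : SMul ℝ InvariantOp :=
  ⟨fun r X => ⟨r • X.diag, r • X.c₁, r • X.c₂, r * X.g, r * X.h⟩⟩

instance : One InvariantOp := ⟨⟨fun _ _ _ _ => 1, 0, 0, 0, 0⟩⟩

@[simp] lemma diag_add (X Y : InvariantOp) : (X + Y).diag = X.diag + Y.diag := rfl
@[simp] lemma c₁_add (X Y : InvariantOp) : (X + Y).c₁ = X.c₁ + Y.c₁ := rfl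
@[simp] lemma c₂_add (X Y : InvariantOp) : (X + Y).c₂ = X.c₂ + Y.c₂ := rfl
@[simp] lemma g_add (X Y : InvariantOp) : (X + Y).g = X.g + Y.g := rfl
@[simp] lemma h_add (X Y : InvariantOp) : (X + Y).h = X.h + Y.h := rfl
@[simp] lemma diag_sub (X Y : InvariantOp) : (X - Y).diag = X.diag - Y.diag := rfl
@[simp] lemma c₁_sub (X Y : InvariantOp) : (X - Y).c₁ = X.c₁ - Y.c₁ := rfl
@[simp] lemma c₂_sub (X Y : InvariantOp) : (X - Y).c₂ = X.c₂ - Y.c₂ := rfl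
@[simp] lemma g_sub (X Y : InvariantOp) : (X - Y).g = X.g - Y.g := rfl
@[simp] lemma h_sub (X Y : InvariantOp) : (X - Y).h = X.h - Y.h := rfl
@[simp] lemma diag_smul (r : ℝ) (X : InvariantOp) : (r • X).diag = r • X.diag := rfl
@[simp] lemma c₁_smul (r : ℝ) (X : InvariantOp) : (r • X).c₁ = r • X.c₁ := rfl
@[simp] lemma c₂_smul (r : ℝ) (X : InvariantOp) : (r • X).c₂ = r • X.c₂ := rfl
@[simp] lemma g_smul (r : ℝ) (X : InvariantOp) : (r • X).g = r * X.g := rfl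
@[simp] lemma h_smul (r : ℝ) (X : InvariantOp) : (r • X).h = r * X.h := rfl
@[simp] lemma diag_one : (1 : InvariantOp).diag = fun _ _ _ _ => 1 := rfl
@[simp] lemma c₁_one : (1 : InvariantOp).c₁ = 0 := rfl
@[simp] lemma c₂_one : (1 : InvariantOp).c₂ = 0 := rfl
@[simp] lemma g_one : (1 : InvariantOp).g = 0 := rfl
@[simp] lemma h_one : (1 : InvariantOp).h = 0 := rfl

/-- The matrix of an invariant operator, with real entries. -/
def toReal (X : InvariantOp) :
    Matrix ((Fin 2 × Fin 2) × (Fin 2 × Fin 2)) ((Fin 2 × Fin 2) × (Fin 2 × Fin 2)) ℝ :=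
  Matrix.of fun a b =>
    if a.1 = b.1 then
      if a.2 = b.2 then X.diag a.1.1 a.1.2 a.2.1 a.2.2
      else if a.2.1 = a.2.2 ∧ b.2.1 = b.2.2 then X.c₂ a.1.1 a.1.2 else 0
    else if a.1.1 = a.1.2 ∧ b.1.1 = b.1.2 then
      if a.2 = b.2 then X.c₁ a.2.1 a.2.2
      else if a.2.1 = a.2.2 ∧ b.2.1 = b.2.2 then
        if a.1.1 = a.2.1 then X.g else X.h
      else 0
    else 0

/-- The operator on `I₁ ⊗ O₁ ⊗ I₂ ⊗ O₂` given by an invariant operator. -/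
def toOp (X : InvariantOp) : Op (Fin 2) (Fin 2) (Fin 2) (Fin 2) :=
  X.toReal.map (fun x : ℝ => (x : ℂ))

lemma toOp_add (X Y : InvariantOp) : (X + Y).toOp = X.toOp + Y.toOp := by
  ext a b
  simp only [toOp, toReal, Matrix.map_apply, Matrix.of_apply, Matrix.add_apply]
  split_ifs <;> simp

lemma toOp_sub (X Y : InvariantOp) : (X - Y).toOp = X.toOp - Y.toOp := by
  ext a b
  simp only [toOp, toReal, Matrix.map_apply, Matrix.of_apply, Matrix.sub_apply]
  split_ifs <;> simp

lemma toOp_smul (r : ℝ) (X : InvariantOp) : (r • X).toOp = (r : ℂ) • X.toOp := by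
  ext a b
  simp only [toOp, toReal, Matrix.map_apply, Matrix.of_apply, Matrix.smul_apply]
  split_ifs <;> simp

lemma toOp_one : (1 : InvariantOp).toOp = 1 := by
  ext ⟨a, b⟩ ⟨a', b'⟩
  simp only [toOp, toReal, Matrix.map_apply, Matrix.of_apply, Matrix.one_apply, Prod.mk.injEq]
  by_cases h₁ : a = a' <;> by_cases h₂ : b = b' <;> simp [h₁, h₂]

/-- Trace-and-replace on `O₁`. -/
noncomputable def replO₁ (X : InvariantOp) : InvariantOp where
  diag i₁ _ i₂ o₂ := (X.diag i₁ 0 i₂ o₂ + X.diag i₁ 1 i₂ o₂) / 2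
  c₁ _ _ := 0
  c₂ i₁ _ := (X.c₂ i₁ 0 + X.c₂ i₁ 1) / 2
  g := 0
  h := 0

/-- Coherences of slot 1 join different states of `O₁`, so tracing out `O₁` kills `c₁`, `g` and `h`,
while `c₂` is averaged. The other three systems behave alike, so certificates can be checked on
entries. -/
lemma replO₁_toOp (X : InvariantOp) :
    ChannelDiscrimination.replO₁ X.toOp = X.replO₁.toOp := by
  ext ⟨⟨a, b⟩, ⟨c, d⟩⟩ ⟨⟨a', b'⟩, ⟨c', d'⟩⟩
  simp only [ChannelDiscrimination.replO₁, toOp, Matrix.map_apply, toReal, Matrix.of_apply,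
    replO₁, Prod.mk.injEq, Fin.sum_univ_two, Fintype.card_fin]
  revert a a' b b' c c' d d'
  simp [Fin.forall_fin_two]
  ring_nf
  simp

/-- Trace-and-replace on `O₂`. -/
noncomputable def replO₂ (X : InvariantOp) : InvariantOp where
  diag i₁ o₁ i₂ _ := (X.diag i₁ o₁ i₂ 0 + X.diag i₁ o₁ i₂ 1) / 2
  c₁ i₂ _ := (X.c₁ i₂ 0 + X.c₁ i₂ 1) / 2
  c₂ _ _ := 0
  g := 0
  h := 0

lemma replO₂_toOp (X : InvariantOp) :
    ChannelDiscrimination.replO₂ X.toOp = X.replO₂.toOp := by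
  ext ⟨⟨a, b⟩, ⟨c, d⟩⟩ ⟨⟨a', b'⟩, ⟨c', d'⟩⟩
  simp only [ChannelDiscrimination.replO₂, toOp, Matrix.map_apply, toReal, Matrix.of_apply,
    replO₂, Prod.mk.injEq, Fin.sum_univ_two, Fintype.card_fin]
  revert a a' b b' c c' d d'
  simp [Fin.forall_fin_two]
  ring_nf
  simp

/-- Trace-and-replace on `I₁`. -/
noncomputable def replI₁ (X : InvariantOp) : InvariantOp where
  diag _ o₁ i₂ o₂ := (X.diag 0 o₁ i₂ o₂ + X.diag 1 o₁ i₂ o₂) / 2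
  c₁ _ _ := 0
  c₂ _ o₁ := (X.c₂ 0 o₁ + X.c₂ 1 o₁) / 2
  g := 0
  h := 0

lemma replI₁_toOp (X : InvariantOp) :
    ChannelDiscrimination.replI₁ X.toOp = X.replI₁.toOp := by
  ext ⟨⟨a, b⟩, ⟨c, d⟩⟩ ⟨⟨a', b'⟩, ⟨c', d'⟩⟩
  simp only [ChannelDiscrimination.replI₁, toOp, Matrix.map_apply, toReal, Matrix.of_apply,
    replI₁, Prod.mk.injEq, Fin.sum_univ_two, Fintype.card_fin]
  revert a a' b b' c c' d d'
  simp [Fin.forall_fin_two]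
  ring_nf
  simp

/-- Trace-and-replace on `I₂`. -/
noncomputable def replI₂ (X : InvariantOp) : InvariantOp where
  diag i₁ o₁ _ o₂ := (X.diag i₁ o₁ 0 o₂ + X.diag i₁ o₁ 1 o₂) / 2
  c₁ _ o₂ := (X.c₁ 0 o₂ + X.c₁ 1 o₂) / 2
  c₂ _ _ := 0
  g := 0
  h := 0

lemma replI₂_toOp (X : InvariantOp) :
    ChannelDiscrimination.replI₂ X.toOp = X.replI₂.toOp := by
  ext ⟨⟨a, b⟩, ⟨c, d⟩⟩ ⟨⟨a', b'⟩, ⟨c', d'⟩⟩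
  simp only [ChannelDiscrimination.replI₂, toOp, Matrix.map_apply, toReal, Matrix.of_apply,
    replI₂, Prod.mk.injEq, Fin.sum_univ_two, Fintype.card_fin]
  revert a a' b b' c c' d d'
  simp [Fin.forall_fin_two]
  ring_nf
  simp

/-- Nonnegativity of the blocks of an invariant operator. -/
structure BlockNonneg (X : InvariantOp) : Prop where
  central : ∀ p q r t : ℝ, 0 ≤ X.diag 0 0 0 0 * p ^ 2 + X.diag 0 0 1 1 * q ^ 2 +
    X.diag 1 1 0 0 * r ^ 2 + X.diag 1 1 1 1 * t ^ 2 + 2 * (X.c₂ 0 0 * (p * q) +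
    X.c₁ 0 0 * (p * r) + X.g * (p * t) + X.h * (q * r) + X.c₁ 1 1 * (q * t) + X.c₂ 1 1 * (r * t))
  pair₁₀ : ∀ p q : ℝ, 0 ≤ X.diag 0 0 1 0 * p ^ 2 + X.diag 1 1 1 0 * q ^ 2 +
    2 * (X.c₁ 1 0 * (p * q))
  pair₁₁ : ∀ p q : ℝ, 0 ≤ X.diag 0 0 0 1 * p ^ 2 + X.diag 1 1 0 1 * q ^ 2 +
    2 * (X.c₁ 0 1 * (p * q))
  pair₂₀ : ∀ p q : ℝ, 0 ≤ X.diag 1 0 0 0 * p ^ 2 + X.diag 1 0 1 1 * q ^ 2 +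
    2 * (X.c₂ 1 0 * (p * q))
  pair₂₁ : ∀ p q : ℝ, 0 ≤ X.diag 0 1 0 0 * p ^ 2 + X.diag 0 1 1 1 * q ^ 2 +
    2 * (X.c₂ 0 1 * (p * q))
  single₀₀ : 0 ≤ X.diag 1 0 1 0
  single₀₁ : 0 ≤ X.diag 1 0 0 1
  single₁₀ : 0 ≤ X.diag 0 1 1 0
  single₁₁ : 0 ≤ X.diag 0 1 0 1

lemma BlockNonneg.add {X Y : InvariantOp} (hX : X.BlockNonneg) (hY : Y.BlockNonneg) :
    (X + Y).BlockNonneg where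
  central p q r t := (add_nonneg (hX.central p q r t) (hY.central p q r t)).trans_eq (by simp; ring)
  pair₁₀ p q := (add_nonneg (hX.pair₁₀ p q) (hY.pair₁₀ p q)).trans_eq (by simp; ring)
  pair₁₁ p q := (add_nonneg (hX.pair₁₁ p q) (hY.pair₁₁ p q)).trans_eq (by simp; ring)
  pair₂₀ p q := (add_nonneg (hX.pair₂₀ p q) (hY.pair₂₀ p q)).trans_eq (by simp; ring)
  pair₂₁ p q := (add_nonneg (hX.pair₂₁ p q) (hY.pair₂₁ p q)).trans_eq (by simp; ring)
  single₀₀ := add_nonneg hX.single₀₀ hY.single₀₀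
  single₀₁ := add_nonneg hX.single₀₁ hY.single₀₁
  single₁₀ := add_nonneg hX.single₁₀ hY.single₁₀
  single₁₁ := add_nonneg hX.single₁₁ hY.single₁₁

lemma BlockNonneg.posSemidef {X : InvariantOp} (hX : X.BlockNonneg) : X.toOp.PosSemidef := by
  refine posSemidef_map_ofReal (.of_dotProduct_mulVec_nonneg ?_ fun z => ?_)
  · ext ⟨⟨a, b⟩, ⟨c, d⟩⟩ ⟨⟨a', b'⟩, ⟨c', d'⟩⟩
    simp only [toReal, Matrix.conjTranspose_apply, Matrix.of_apply, Prod.mk.injEq]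
    revert a a' b b' c c' d d'
    simp [Fin.forall_fin_two]
  · have h₁ := hX.central (z ((0, 0), (0, 0))) (z ((0, 0), (1, 1))) (z ((1, 1), (0, 0)))
      (z ((1, 1), (1, 1)))
    have h₂ := hX.pair₁₀ (z ((0, 0), (1, 0))) (z ((1, 1), (1, 0)))
    have h₃ := hX.pair₁₁ (z ((0, 0), (0, 1))) (z ((1, 1), (0, 1)))
    have h₄ := hX.pair₂₀ (z ((1, 0), (0, 0))) (z ((1, 0), (1, 1)))
    have h₅ := hX.pair₂₁ (z ((0, 1), (0, 0))) (z ((0, 1), (1, 1)))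
    have h₆ := mul_nonneg hX.single₀₀ (sq_nonneg (z ((1, 0), (1, 0))))
    have h₇ := mul_nonneg hX.single₀₁ (sq_nonneg (z ((1, 0), (0, 1))))
    have h₈ := mul_nonneg hX.single₁₀ (sq_nonneg (z ((0, 1), (1, 0))))
    have h₉ := mul_nonneg hX.single₁₁ (sq_nonneg (z ((0, 1), (0, 1))))
    -- Invariance leaves no coherence between different blocks, so the full quadratic form is the
    -- sum of these nine.
    refine (add_nonneg (add_nonneg (add_nonneg (add_nonneg (add_nonneg (add_nonneg (add_nonneg
      (add_nonneg h₁ h₂) h₃) h₄) h₅) h₆) h₇) h₈) h₉).trans_eq ?_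
    simp [dotProduct, Matrix.mulVec, Fintype.sum_prod_type, toReal]
    ring

lemma trace_toOp (X : InvariantOp) :
    X.toOp.trace = ((∑ i₁, ∑ o₁, ∑ i₂, ∑ o₂, X.diag i₁ o₁ i₂ o₂ : ℝ) : ℂ) := by
  simp [Matrix.trace, Fintype.sum_prod_type, toOp, toReal]

lemma trace_toOp_mul (X Y : InvariantOp) : (X.toOp * Y.toOp).trace.re =
    ∑ i₁, ∑ o₁, ∑ i₂, ∑ o₂, X.diag i₁ o₁ i₂ o₂ * Y.diag i₁ o₁ i₂ o₂ +
    2 * (∑ i, ∑ o, (X.c₁ i o * Y.c₁ i o + X.c₂ i o * Y.c₂ i o) + X.g * Y.g + X.h * Y.h) := by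
  simp [Matrix.trace, Matrix.mul_apply, Fintype.sum_prod_type, toOp, toReal]
  ring

/-- For `η = 0`, the operator `C ⊗ C` of an amplitude-damping channel with `κ = 1 - γ` and
`s = √κ`; for `s` within `η` of this value, an upper bound for it. -/
def dampingMajorant (γ κ s η : ℝ) : InvariantOp where
  diag := ![![![![1 + η, 0], ![γ * (1 + η), κ + η]], ![![0, 0], ![0, 0]]],
    ![![![γ * (1 + η), 0], ![γ ^ 2, γ * (κ + η)]],
      ![![κ + η, 0], ![γ * (κ + η), κ ^ 2 * (1 + η)]]]]
  c₁ := ![![s, 0], ![γ * s, κ * s]]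
  c₂ := ![![s, 0], ![γ * s, κ * s]]
  g := κ * (1 + η)
  h := κ + η

/-- The only coherence in the Choi operator of amplitude damping is between `|00⟩` and `|11⟩`, hence
its tensor square is an invariant operator. -/
lemma choi_kronecker_choi {γ : ℝ} (h₀ : 0 ≤ γ) (h₁ : γ ≤ 1) :
    choi (amplitudeDamping γ) ⊗ₖ choi (amplitudeDamping γ) =
      (dampingMajorant γ (1 - γ) √(1 - γ) 0).toOp := by
  have hs : ((√(1 - γ) : ℝ) : ℂ) * ((√(1 - γ) : ℝ) : ℂ) = 1 - γ := by
    rw [← Complex.ofReal_mul, Real.mul_self_sqrt (by linarith)]; simp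
  have hg : ((√γ : ℝ) : ℂ) * ((√γ : ℝ) : ℂ) = γ := by
    rw [← Complex.ofReal_mul, Real.mul_self_sqrt h₀]
  have key : choi (amplitudeDamping γ) = Matrix.of fun a b =>
      if a = (0, 0) ∧ b = (0, 0) then 1 else
      if a = (1, 1) ∧ b = (1, 1) then 1 - (γ : ℂ) else
      if a = (1, 0) ∧ b = (1, 0) then (γ : ℂ) else
      if a = (0, 0) ∧ b = (1, 1) ∨ a = (1, 1) ∧ b = (0, 0) then ((√(1 - γ) : ℝ) : ℂ) else 0 := by
    ext ⟨a, b⟩ ⟨a', b'⟩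
    simp only [choi, amplitudeDamping, krausMap, LinearMap.coe_mk, AddHom.coe_mk, Matrix.of_apply]
    revert a b a' b'
    simp [Fin.forall_fin_two]
    simp [Matrix.vecMul, dotProduct, Fin.sum_univ_two, Matrix.mul_apply, Matrix.single_apply,
      hs, hg]
  rw [key]
  ext ⟨⟨a, b⟩, ⟨c, d⟩⟩ ⟨⟨a', b'⟩, ⟨c', d'⟩⟩
  simp only [Matrix.kroneckerMap_apply, toOp, toReal, Matrix.map_apply, Matrix.of_apply,
    dampingMajorant, Prod.mk.injEq]
  revert a a' b b' c c' d d'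
  simp [Fin.forall_fin_two, hs, sq]
  exact ⟨⟨mul_comm _ _, mul_comm _ _⟩, ⟨mul_comm _ _, mul_comm _ _⟩, mul_comm _ _⟩

end InvariantOp

/-! ### Compactness of the tester sets. -/

section Compactness

set_option linter.unusedSectionVars false

lemma isClosed_posSemidef {n : Type*} [Fintype n] :
    IsClosed {A : Matrix n n ℂ | A.PosSemidef} := by
  simp only [Matrix.posSemidef_iff_dotProduct_mulVec, Set.ofPred_and, Set.ofPred_forall]
  refine IsClosed.inter ?_ (isClosed_iInter fun x => ?_)
  · exact isClosed_eq (by fun_prop) continuous_id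
  · exact isClosed_le continuous_const (by fun_prop)

/-- Writing `A = B* B`, an entry is an inner product of two columns of `B`, and the trace is the sum
of all `‖B k l‖ ^ 2`. This makes the trace bound a bound on every entry. -/
lemma norm_apply_le_trace_of_posSemidef {n : Type*} [Fintype n] {A : Matrix n n ℂ}
    (hA : A.PosSemidef) (i j : n) : ‖A i j‖ ≤ A.trace.re := by
  classical
  open scoped MatrixOrder in
  obtain ⟨B, rfl⟩ := CStarAlgebra.nonneg_iff_eq_star_mul_self.mp hA.nonneg
  have key : ∀ k i, ‖B k i‖ ^ 2 ≤ ∑ l, ‖B k l‖ ^ 2 := fun k i =>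
    Finset.single_le_sum (f := fun l => ‖B k l‖ ^ 2) (fun _ _ => by positivity)
      (Finset.mem_univ i)
  have htr : (star B * B).trace.re = ∑ k, ∑ l, ‖B k l‖ ^ 2 := by
    rw [Finset.sum_comm]
    simp [Matrix.trace, Matrix.mul_apply, Matrix.star_eq_conjTranspose, Complex.sq_norm,
      Complex.normSq_apply]
  rw [htr, Matrix.mul_apply]
  refine (norm_sum_le _ _).trans (Finset.sum_le_sum fun k _ => ?_)
  rw [Matrix.star_eq_conjTranspose, Matrix.conjTranspose_apply, norm_mul, norm_star]
  nlinarith [key k i, key k j, sq_nonneg (‖B k i‖ - ‖B k j‖)]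

lemma isCompact_posSemidef_trace_le {n : Type*} [Fintype n] (c : ℝ) :
    IsCompact {A : Matrix n n ℂ | A.PosSemidef ∧ A.trace.re ≤ c} := by
  have hK : IsCompact (Set.univ.pi fun _ : n => Set.univ.pi fun _ : n =>
      Metric.closedBall (0 : ℂ) c) :=
    isCompact_univ_pi fun _ => isCompact_univ_pi fun _ => isCompact_closedBall 0 c
  have hc : IsClosed {A : Matrix n n ℂ | A.trace.re ≤ c} :=
    isClosed_le (Complex.continuous_re.comp (by fun_prop)) continuous_const
  refine hK.of_isClosed_subset (isClosed_posSemidef.inter hc) ?_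
  · rintro A ⟨hA, hc⟩ i - j -
    exact mem_closedBall_zero_iff.mpr ((norm_apply_le_trace_of_posSemidef hA i j).trans hc)

variable {I₁ O₁ I₂ O₂ : Type*}

@[fun_prop]
lemma continuous_replI₁ [Fintype I₁] [DecidableEq I₁] :
    Continuous (replI₁ : Op I₁ O₁ I₂ O₂ → Op I₁ O₁ I₂ O₂) := by
  refine continuous_matrix fun a b => ?_
  simp only [replI₁, Matrix.of_apply]
  split_ifs <;> fun_prop

@[fun_prop]
lemma continuous_replO₁ [Fintype O₁] [DecidableEq O₁] :
    Continuous (replO₁ : Op I₁ O₁ I₂ O₂ → Op I₁ O₁ I₂ O₂) := by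
  refine continuous_matrix fun a b => ?_
  simp only [replO₁, Matrix.of_apply]
  split_ifs <;> fun_prop

@[fun_prop]
lemma continuous_replI₂ [Fintype I₂] [DecidableEq I₂] :
    Continuous (replI₂ : Op I₁ O₁ I₂ O₂ → Op I₁ O₁ I₂ O₂) := by
  refine continuous_matrix fun a b => ?_
  simp only [replI₂, Matrix.of_apply]
  split_ifs <;> fun_prop

@[fun_prop]
lemma continuous_replO₂ [Fintype O₂] [DecidableEq O₂] :
    Continuous (replO₂ : Op I₁ O₁ I₂ O₂ → Op I₁ O₁ I₂ O₂) := by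
  refine continuous_matrix fun a b => ?_
  simp only [replO₂, Matrix.of_apply]
  split_ifs <;> fun_prop

variable [Fintype I₁] [Fintype O₁] [Fintype I₂] [Fintype O₂]

lemma isCompact_isNormalized : IsCompact {W : Op I₁ O₁ I₂ O₂ | IsNormalized W} := by
  refine (isCompact_posSemidef_trace_le
    ((Fintype.card O₁ : ℂ) * (Fintype.card O₂ : ℂ)).re).of_isClosed_subset
    (isClosed_posSemidef.inter (isClosed_eq (by fun_prop) continuous_const)) ?_
  rintro W ⟨hW, ht⟩
  exact ⟨hW, (congrArg Complex.re ht).le⟩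

variable [DecidableEq I₁] [DecidableEq O₁] [DecidableEq I₂] [DecidableEq O₂]

lemma isCompact_isParallelProcess : IsCompact {W : Op I₁ O₁ I₂ O₂ | IsParallelProcess W} :=
  isCompact_isNormalized.inter_right (isClosed_eq (by fun_prop) (by fun_prop))

lemma isCompact_isSequentialProcess : IsCompact {W : Op I₁ O₁ I₂ O₂ | IsSequentialProcess W} :=
  isCompact_isNormalized.inter_right
    ((isClosed_eq (by fun_prop) (by fun_prop)).inter (isClosed_eq (by fun_prop) (by fun_prop)))

lemma isCompact_isSequentialProcess' : IsCompact {W : Op I₁ O₁ I₂ O₂ | IsSequentialProcess' W} :=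
  isCompact_isNormalized.inter_right
    ((isClosed_eq (by fun_prop) (by fun_prop)).inter (isClosed_eq (by fun_prop) (by fun_prop)))

lemma isCompact_isGeneralProcess : IsCompact {W : Op I₁ O₁ I₂ O₂ | IsGeneralProcess W} :=
  isCompact_isNormalized.inter_right
    ((isClosed_eq (by fun_prop) (by fun_prop)).inter ((isClosed_eq (by fun_prop)
      (by fun_prop)).inter (isClosed_eq (by fun_prop) (by fun_prop))))

/-- Closedness is not visible from the existential; it comes from the continuous image of the
compact set of triples `(q, W₁₂, W₂₁)`. -/
lemma isCompact_isSeparableProcess : IsCompact {W : Op I₁ O₁ I₂ O₂ | IsSeparableProcess W} := by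
  have hK := (isCompact_Icc (a := (0 : ℝ)) (b := 1)).prod
    ((isCompact_isSequentialProcess (I₁ := I₁) (O₁ := O₁) (I₂ := I₂) (O₂ := O₂)).prod
      (isCompact_isSequentialProcess' (I₁ := I₁) (O₁ := O₁) (I₂ := I₂) (O₂ := O₂)))
  have hf : Continuous fun x : ℝ × Op I₁ O₁ I₂ O₂ × Op I₁ O₁ I₂ O₂ =>
      (x.1 : ℂ) • x.2.1 + ((1 - x.1 : ℝ) : ℂ) • x.2.2 := by fun_prop
  convert isCompact_isNormalized.inter_right (hK.image hf).isClosed using 1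
  refine Set.ext fun W => and_congr_right fun _ => ⟨?_, ?_⟩
  · rintro ⟨q, W₁, W₂, h₀, h₁, hW₁, hW₂, rfl⟩
    exact ⟨(q, W₁, W₂), ⟨⟨h₀, h₁⟩, hW₁, hW₂⟩, rfl⟩
  · rintro ⟨⟨q, W₁, W₂⟩, ⟨⟨h₀, h₁⟩, hW₁, hW₂⟩, rfl⟩
    exact ⟨q, W₁, W₂, h₀, h₁, hW₁, hW₂, rfl⟩

lemma isCompact_isProcess (S : Strategy) : IsCompact {W : Op I₁ O₁ I₂ O₂ | IsProcess S W} := by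
  cases S
  · exact isCompact_isParallelProcess
  · exact isCompact_isSequentialProcess
  · exact isCompact_isSeparableProcess
  · exact isCompact_isGeneralProcess

lemma IsProcess.isNormalized {S : Strategy} {W : Op I₁ O₁ I₂ O₂} (hW : IsProcess S W) :
    IsNormalized W := by
  cases S <;> exact hW.1

lemma isCompact_isTester {ι : Type*} [Fintype ι] (S : Strategy) :
    IsCompact {T : ι → Op I₁ O₁ I₂ O₂ | IsTester S T} := by
  have hK := isCompact_univ_pi fun _ : ι => isCompact_posSemidef_trace_le
    (n := (I₁ × O₁) × (I₂ × O₂)) ((Fintype.card O₁ : ℂ) * (Fintype.card O₂ : ℂ)).re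
  refine hK.of_isClosed_subset ?_ ?_
  · simp only [IsTester, Set.ofPred_and, Set.ofPred_forall]
    refine IsClosed.inter (isClosed_iInter fun i => ?_) ?_
    · exact isClosed_posSemidef.preimage (f := fun T : ι → Op I₁ O₁ I₂ O₂ => T i)
        (continuous_apply i)
    · exact (isCompact_isProcess S).isClosed.preimage
        (f := fun T : ι → Op I₁ O₁ I₂ O₂ => ∑ i, T i) (by fun_prop)
  · rintro T ⟨hT, hW⟩ i -
    refine ⟨hT i, ?_⟩
    -- The traces of the tester elements are nonnegative and sum to the fixed trace of the process,
    -- so each is bounded by it.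
    rw [← hW.isNormalized.2, Matrix.trace_sum, Complex.re_sum]
    exact Finset.single_le_sum (f := fun j => (T j).trace.re)
      (fun j _ => (Complex.le_def.mp (hT j).trace_nonneg).1) (Finset.mem_univ i)

lemma isGreatest_maxSuccess {ι I O : Type*} [Fintype ι] [Fintype I] [Fintype O] [DecidableEq I]
    [DecidableEq O] {S : Strategy} {p : ι → ℝ} {Φ : ι → Matrix I I ℂ →ₗ[ℂ] Matrix O O ℂ}
    (h : (successProbabilities S p Φ).Nonempty) :
    IsGreatest (successProbabilities S p Φ) (maxSuccess S p Φ) := by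
  have hc : Continuous (successProbability p Φ) := by
    unfold successProbability
    refine continuous_finsetSum _ fun i _ => continuous_const.mul
      (Complex.continuous_re.comp ?_)
    fun_prop
  have hs : successProbabilities S p Φ = successProbability p Φ '' {T | IsTester S T} := by
    ext r
    exact ⟨fun ⟨T, hT, hr⟩ => ⟨T, hT, hr.symm⟩, fun ⟨T, hT, hr⟩ => ⟨T, hT, hr.symm⟩⟩
  exact IsCompact.isGreatest_sSup (hs ▸ (isCompact_isTester S).image hc) h

end Compactness

/-! ### Dual operators with constant value on a process class. -/

section Duality

variable {I₁ O₁ I₂ O₂ : Type*} [Fintype I₁] [Fintype O₁] [Fintype I₂] [Fintype O₂]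
  [DecidableEq I₁] [DecidableEq O₁] [DecidableEq I₂] [DecidableEq O₂]

lemma IsParallelProcess.trace_mul {W X : Op I₁ O₁ I₂ O₂} (hW : IsParallelProcess W) {c : ℂ}
    (hX : replO₂ (replO₁ X) = c • 1) :
    (W * X).trace = c * ((Fintype.card O₁ : ℂ) * (Fintype.card O₂ : ℂ)) := by
  rw [hW.2, trace_replO₁_mul, trace_replO₂_mul, hX, Matrix.mul_smul, mul_one, Matrix.trace_smul,
    hW.1.2, smul_eq_mul]

lemma IsSequentialProcess.trace_mul {W X : Op I₁ O₁ I₂ O₂} (hW : IsSequentialProcess W) {c : ℂ}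
    (hX : replO₂ X - replO₂ (replI₂ X) + replO₂ (replI₂ (replO₁ X)) = c • 1) :
    (W * X).trace = c * ((Fintype.card O₁ : ℂ) * (Fintype.card O₂ : ℂ)) := by
  have h : (W * X).trace = (W * (c • 1)).trace := by
    -- Both linear constraints are packed into one fixed-point equation. Moving its map across the
    -- trace reverses the order of the compositions, which gives the form of `hX`.
    have h' : W = replO₂ W - replI₂ (replO₂ W) + replO₁ (replI₂ (replO₂ W)) := by
      rw [← hW.2.2, sub_add_cancel, ← hW.2.1]
    conv_lhs => rw [h']
    rw [← hX]
    simp only [Matrix.add_mul, Matrix.sub_mul, Matrix.mul_add, Matrix.mul_sub, Matrix.trace_add,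
      Matrix.trace_sub, trace_replO₁_mul, trace_replO₂_mul, trace_replI₂_mul]
  rw [h, Matrix.mul_smul, mul_one, Matrix.trace_smul, hW.1.2, smul_eq_mul]

lemma IsSequentialProcess'.trace_mul {W X : Op I₁ O₁ I₂ O₂} (hW : IsSequentialProcess' W) {c : ℂ}
    (hX : replO₁ X - replO₁ (replI₁ X) + replO₁ (replI₁ (replO₂ X)) = c • 1) :
    (W * X).trace = c * ((Fintype.card O₁ : ℂ) * (Fintype.card O₂ : ℂ)) := by
  have h : (W * X).trace = (W * (c • 1)).trace := by
    have h' : W = replO₁ W - replI₁ (replO₁ W) + replO₂ (replI₁ (replO₁ W)) := by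
      rw [← hW.2.2, sub_add_cancel, ← hW.2.1]
    conv_lhs => rw [h']
    rw [← hX]
    simp only [Matrix.add_mul, Matrix.sub_mul, Matrix.mul_add, Matrix.mul_sub, Matrix.trace_add,
      Matrix.trace_sub, trace_replO₁_mul, trace_replO₂_mul, trace_replI₁_mul]
  rw [h, Matrix.mul_smul, mul_one, Matrix.trace_smul, hW.1.2, smul_eq_mul]

lemma IsGeneralProcess.trace_mul {W X : Op I₁ O₁ I₂ O₂} (hW : IsGeneralProcess W) {c : ℂ}
    (hX : replO₁ X + replO₂ X - replO₂ (replO₁ X) - (replO₁ (replI₁ X) -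
      replO₂ (replO₁ (replI₁ X))) - (replO₂ (replI₂ X) - replO₂ (replI₂ (replO₁ X))) = c • 1) :
    (W * X).trace = c * ((Fintype.card O₁ : ℂ) * (Fintype.card O₂ : ℂ)) := by
  have h : (W * X).trace = (W * (c • 1)).trace := by
    -- The two brackets vanish by the first two constraints; including them makes the condition on
    -- `X` weak enough for a useful dual.
    have h' : W = replO₁ W + replO₂ W - replO₁ (replO₂ W) - (replI₁ (replO₁ W) -
        replI₁ (replO₁ (replO₂ W))) - (replI₂ (replO₂ W) - replO₁ (replI₂ (replO₂ W))) := by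
      rw [← hW.2.1, ← hW.2.2.1, sub_self, sub_self, sub_zero, sub_zero, ← hW.2.2.2]
    conv_lhs => rw [h']
    rw [← hX]
    simp only [Matrix.add_mul, Matrix.sub_mul, Matrix.mul_add, Matrix.mul_sub, Matrix.trace_add,
      Matrix.trace_sub, trace_replO₁_mul, trace_replO₂_mul, trace_replI₁_mul, trace_replI₂_mul]
  rw [h, Matrix.mul_smul, mul_one, Matrix.trace_smul, hW.1.2, smul_eq_mul]

end Duality

/-! ### Minor tests and the passage from irrational to rational operators. -/

namespace InvariantOp

/-- Positivity of the leading minors of a real symmetric `3 × 3` matrix, given by its diagonal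
entries and its entries at `(1, 2)`, `(1, 3)`, `(2, 3)`, in the form of fraction-free elimination. -/
def MinorsPos₃ (a b c ab ac bc : ℝ) : Prop :=
  0 < a ∧ 0 < a * b - ab ^ 2 ∧
    0 ≤ (a * b - ab ^ 2) * (a * c - ac ^ 2) - (a * bc - ab * ac) ^ 2

/-- Positivity of the leading minors of a real symmetric `4 × 4` matrix, given by its diagonal
entries and its entries above the diagonal, in the form of fraction-free elimination. -/
def MinorsPos₄ (a b c d ab ac ad bc bd cd : ℝ) : Prop :=
  0 < a ∧ MinorsPos₃ (a * b - ab ^ 2) (a * c - ac ^ 2) (a * d - ad ^ 2) (a * bc - ab * ac)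
    (a * bd - ab * ad) (a * cd - ac * ad)

lemma quadraticForm₂_nonneg {a b ab : ℝ} (ha : 0 < a) (h : 0 ≤ a * b - ab ^ 2) (p q : ℝ) :
    0 ≤ a * p ^ 2 + b * q ^ 2 + 2 * (ab * (p * q)) := by
  refine nonneg_of_mul_nonneg_right (a := a) ?_ ha
  have := mul_nonneg h (sq_nonneg q)
  nlinarith [sq_nonneg (a * p + ab * q)]

/-- Completing the square: `a` times the form is a square plus the form of the fraction-free Schur
complement, which has one variable less. -/
lemma quadraticForm₃_nonneg {a b c ab ac bc : ℝ} (h : MinorsPos₃ a b c ab ac bc) (p q r : ℝ) :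
    0 ≤ a * p ^ 2 + b * q ^ 2 + c * r ^ 2 +
      2 * (ab * (p * q) + ac * (p * r) + bc * (q * r)) := by
  refine nonneg_of_mul_nonneg_right (a := a) ?_ h.1
  have := quadraticForm₂_nonneg h.2.1 h.2.2 q r
  linear_combination this + sq_nonneg (a * p + ab * q + ac * r)

lemma quadraticForm₄_nonneg {a b c d ab ac ad bc bd cd : ℝ}
    (h : MinorsPos₄ a b c d ab ac ad bc bd cd) (p q r t : ℝ) :
    0 ≤ a * p ^ 2 + b * q ^ 2 + c * r ^ 2 + d * t ^ 2 +
      2 * (ab * (p * q) + ac * (p * r) + ad * (p * t) + bc * (q * r) + bd * (q * t) +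
        cd * (r * t)) := by
  refine nonneg_of_mul_nonneg_right (a := a) ?_ h.1
  have := quadraticForm₃_nonneg h.2 q r t
  linear_combination this + sq_nonneg (a * p + ab * q + ac * r + ad * t)

/-- Positivity of the leading minors of the blocks of an invariant operator. -/
def MinorsPos (X : InvariantOp) : Prop :=
  MinorsPos₄ (X.diag 0 0 0 0) (X.diag 0 0 1 1) (X.diag 1 1 0 0) (X.diag 1 1 1 1) (X.c₂ 0 0)
    (X.c₁ 0 0) X.g X.h (X.c₁ 1 1) (X.c₂ 1 1) ∧
  (0 < X.diag 0 0 1 0 ∧ 0 ≤ X.diag 0 0 1 0 * X.diag 1 1 1 0 - X.c₁ 1 0 ^ 2) ∧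
  (0 < X.diag 0 0 0 1 ∧ 0 ≤ X.diag 0 0 0 1 * X.diag 1 1 0 1 - X.c₁ 0 1 ^ 2) ∧
  (0 < X.diag 1 0 0 0 ∧ 0 ≤ X.diag 1 0 0 0 * X.diag 1 0 1 1 - X.c₂ 1 0 ^ 2) ∧
  (0 < X.diag 0 1 0 0 ∧ 0 ≤ X.diag 0 1 0 0 * X.diag 0 1 1 1 - X.c₂ 0 1 ^ 2) ∧
  0 ≤ X.diag 1 0 1 0 ∧ 0 ≤ X.diag 1 0 0 1 ∧ 0 ≤ X.diag 0 1 1 0 ∧ 0 ≤ X.diag 0 1 0 1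

/-- `MinorsPos` is a finite list of numerical inequalities, suited to concrete certificates.
`BlockNonneg` is closed under sums and allows singular blocks, which the majorant error has. -/
lemma MinorsPos.blockNonneg {X : InvariantOp} (h : X.MinorsPos) : X.BlockNonneg := by
  obtain ⟨h, h₁₀, h₁₁, h₂₀, h₂₁, h₁, h₂, h₃, h₄⟩ := h
  exact ⟨quadraticForm₄_nonneg h, quadraticForm₂_nonneg h₁₀.1 h₁₀.2,
    quadraticForm₂_nonneg h₁₁.1 h₁₁.2, quadraticForm₂_nonneg h₂₀.1 h₂₀.2,
    quadraticForm₂_nonneg h₂₁.1 h₂₁.2, h₁, h₂, h₃, h₄⟩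

lemma BlockNonneg.smul {X : InvariantOp} (hX : X.BlockNonneg) {r : ℝ} (hr : 0 ≤ r) :
    (r • X).BlockNonneg where
  central p q s t := (mul_nonneg hr (hX.central p q s t)).trans_eq (by simp; ring)
  pair₁₀ p q := (mul_nonneg hr (hX.pair₁₀ p q)).trans_eq (by simp; ring)
  pair₁₁ p q := (mul_nonneg hr (hX.pair₁₁ p q)).trans_eq (by simp; ring)
  pair₂₀ p q := (mul_nonneg hr (hX.pair₂₀ p q)).trans_eq (by simp; ring)
  pair₂₁ p q := (mul_nonneg hr (hX.pair₂₁ p q)).trans_eq (by simp; ring)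
  single₀₀ := mul_nonneg hr hX.single₀₀
  single₀₁ := mul_nonneg hr hX.single₀₁
  single₁₀ := mul_nonneg hr hX.single₁₀
  single₁₁ := mul_nonneg hr hX.single₁₁

lemma dampingMajorant_sub_blockNonneg {γ κ s s' η : ℝ} (hγ : 0 ≤ γ) (h : |s - s'| ≤ η) :
    (dampingMajorant γ κ s' η - dampingMajorant γ κ s 0).BlockNonneg := by
  -- Twice this form is `(η + (s - s')) (p - q)² + (η - (s - s')) (p + q)²`.
  have key (p q : ℝ) : 0 ≤ η * p ^ 2 + η * q ^ 2 + 2 * ((s' - s) * (p * q)) := by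
    obtain ⟨h₁, h₂⟩ := abs_le.mp h
    nlinarith [mul_nonneg (by linarith : 0 ≤ η + (s - s')) (sq_nonneg (p - q)),
      mul_nonneg (by linarith : 0 ≤ η - (s - s')) (sq_nonneg (p + q))]
  constructor
  · intro p q r t
    -- The `η` terms of `dampingMajorant` are chosen so that the error on the 4 × 4 block depends
    -- only on these two combinations.
    refine (key (p + κ * t) (q + r)).trans_eq ?_
    simp [dampingMajorant]
    ring
  · intro p q
    refine (mul_nonneg hγ (key p q)).trans_eq ?_
    simp [dampingMajorant]
    ring
  · simp [dampingMajorant]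
  · intro p q
    refine (mul_nonneg hγ (key p q)).trans_eq ?_
    simp [dampingMajorant]
    ring
  all_goals simp [dampingMajorant]

lemma sub_choi_kronecker_choi_posSemidef {γ s η : ℝ} {X : InvariantOp} (h₀ : 0 ≤ γ) (h₁ : γ ≤ 1)
    (hs : |√(1 - γ) - s| ≤ η)
    (hX : (X - (1 / 2 : ℝ) • dampingMajorant γ (1 - γ) s η).MinorsPos) :
    (X.toOp - (1 / 2 : ℂ) •
      (choi (amplitudeDamping γ) ⊗ₖ choi (amplitudeDamping γ))).PosSemidef := by
  -- With `M` the majorant, `X - C ⊗ C / 2` is `(X - M / 2) + (M - C ⊗ C) / 2`.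
  have h := (hX.blockNonneg.add ((dampingMajorant_sub_blockNonneg (κ := 1 - γ) h₀ hs).smul
    (by norm_num : (0 : ℝ) ≤ 1 / 2))).posSemidef
  convert h using 1
  rw [choi_kronecker_choi h₀ h₁, toOp_add, toOp_sub, toOp_smul, toOp_smul, toOp_sub, smul_sub]
  push_cast
  abel

end InvariantOp

/-! ### Weak duality and tester values for the two channels. -/

open InvariantOp

lemma successProbability_twoDampings_le {T : Fin 2 → Op (Fin 2) (Fin 2) (Fin 2) (Fin 2)}
    (hT : ∀ i, (T i).PosSemidef) {X : Op (Fin 2) (Fin 2) (Fin 2) (Fin 2)}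
    (hX : ∀ i, (X - (1 / 2 : ℂ) • (choi (twoDampings i) ⊗ₖ choi (twoDampings i))).PosSemidef) :
    successProbability (fun _ => 1 / 2) twoDampings T ≤ ((∑ i, T i) * X).trace.re := by
  rw [Finset.sum_mul, Matrix.trace_sum, Complex.re_sum]
  refine Finset.sum_le_sum fun i _ => ?_
  have h := trace_mul_re_nonneg (hT i) (hX i)
  rw [Matrix.mul_sub, Matrix.trace_sub, Complex.sub_re, Matrix.mul_smul, Matrix.trace_smul] at h
  simp at h ⊢
  linarith

lemma abs_sqrt_sub_le : |√(1 - 37 / 100 : ℝ) - 793725393319 / 10 ^ 12| ≤ 1 / 10 ^ 12 ∧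
    |√(1 - 87 / 100 : ℝ) - 360555127546 / 10 ^ 12| ≤ 1 / 10 ^ 12 := by
  constructor <;> rw [abs_sub_le_iff]
  · constructor
    · rw [sub_le_iff_le_add', Real.sqrt_le_left (by norm_num)]; norm_num
    · rw [sub_le_comm, Real.le_sqrt' (by norm_num)]; norm_num
  · constructor
    · rw [sub_le_iff_le_add', Real.sqrt_le_left (by norm_num)]; norm_num
    · rw [sub_le_comm, Real.le_sqrt' (by norm_num)]; norm_num

/-- `X` is at least half of each of the two operators `C ⊗ C`. -/
def Dominates (X : InvariantOp) : Prop :=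
  (X - (1 / 2 : ℝ) • dampingMajorant (37 / 100) (63 / 100) (793725393319 / 10 ^ 12)
    (1 / 10 ^ 12)).MinorsPos ∧
  (X - (1 / 2 : ℝ) • dampingMajorant (87 / 100) (13 / 100) (360555127546 / 10 ^ 12)
    (1 / 10 ^ 12)).MinorsPos

lemma Dominates.le_of_mem {X : InvariantOp} (hX : Dominates X) {S : Strategy} {c : ℝ}
    (hc : ∀ W, IsProcess S W → (W * X.toOp).trace.re ≤ c) {r : ℝ}
    (hr : r ∈ successProbabilities S (fun _ => 1 / 2) twoDampings) : r ≤ c := by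
  obtain ⟨T, ⟨hT, hW⟩, rfl⟩ := hr
  refine (successProbability_twoDampings_le hT fun i => ?_).trans (hc _ hW)
  fin_cases i
  · refine sub_choi_kronecker_choi_posSemidef (by norm_num) (by norm_num) abs_sqrt_sub_le.1 ?_
    convert hX.1 using 3
    norm_num
  · refine sub_choi_kronecker_choi_posSemidef (by norm_num) (by norm_num) abs_sqrt_sub_le.2 ?_
    convert hX.2 using 3
    norm_num

/-- The value of the tester `(X, Y)`, as a function of the square roots of the two `1 - γ`. -/
noncomputable def value (X Y : InvariantOp) (s t : ℝ) : ℝ :=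
  (1 / 2) * (X.diag 0 0 0 0 + 63 / 100 * (X.diag 0 0 1 1 + X.diag 1 1 0 0) +
    (63 / 100) ^ 2 * X.diag 1 1 1 1 + 37 / 100 * (X.diag 0 0 1 0 + X.diag 1 0 0 0) +
    37 / 100 * (63 / 100) * (X.diag 1 0 1 1 + X.diag 1 1 1 0) + (37 / 100) ^ 2 * X.diag 1 0 1 0 +
    2 * (63 / 100 * (X.g + X.h)) + 2 * s * (X.c₁ 0 0 + X.c₂ 0 0 +
      37 / 100 * (X.c₁ 1 0 + X.c₂ 1 0) + 63 / 100 * (X.c₁ 1 1 + X.c₂ 1 1))) +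
  (1 / 2) * (Y.diag 0 0 0 0 + 13 / 100 * (Y.diag 0 0 1 1 + Y.diag 1 1 0 0) +
    (13 / 100) ^ 2 * Y.diag 1 1 1 1 + 87 / 100 * (Y.diag 0 0 1 0 + Y.diag 1 0 0 0) +
    87 / 100 * (13 / 100) * (Y.diag 1 0 1 1 + Y.diag 1 1 1 0) + (87 / 100) ^ 2 * Y.diag 1 0 1 0 +
    2 * (13 / 100 * (Y.g + Y.h)) + 2 * t * (Y.c₁ 0 0 + Y.c₂ 0 0 +
      87 / 100 * (Y.c₁ 1 0 + Y.c₂ 1 0) + 13 / 100 * (Y.c₁ 1 1 + Y.c₂ 1 1)))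

lemma successProbability_toOp (X Y : InvariantOp) :
    successProbability (fun _ => 1 / 2) twoDampings ![X.toOp, Y.toOp] =
      value X Y √(63 / 100) √(13 / 100) := by
  have h₁ : (1 - 37 / 100 : ℝ) = 63 / 100 := by norm_num
  have h₂ : (1 - 87 / 100 : ℝ) = 13 / 100 := by norm_num
  rw [successProbability, Fin.sum_univ_two]
  simp only [twoDampings, Matrix.cons_val_zero, Matrix.cons_val_one]
  rw [choi_kronecker_choi (by norm_num) (by norm_num), choi_kronecker_choi (by norm_num)
    (by norm_num), trace_toOp_mul, trace_toOp_mul, h₁, h₂]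
  simp [dampingMajorant, value, Fin.sum_univ_two]
  ring

/-- The sum `W` is kept as separate data so that its linear constraints are checked on literals. The
bound is asked on whole intervals because the two roots are known only up to `10⁻¹²`. -/
lemma exists_mem_successProbabilities {S : Strategy} {X Y W : InvariantOp} (hX : X.MinorsPos)
    (hY : Y.MinorsPos) (hW : X + Y = W) (hS : IsProcess S W.toOp) {c : ℝ}
    (hc : ∀ s t : ℝ, |s - 793725393319 / 10 ^ 12| ≤ 1 / 10 ^ 12 →
      |t - 360555127546 / 10 ^ 12| ≤ 1 / 10 ^ 12 → c < value X Y s t) :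
    ∃ r ∈ successProbabilities S (fun _ => 1 / 2) twoDampings, c < r := by
  refine ⟨_, ⟨![X.toOp, Y.toOp], ⟨fun i => ?_, ?_⟩, rfl⟩, ?_⟩
  · fin_cases i
    · exact hX.blockNonneg.posSemidef
    · exact hY.blockNonneg.posSemidef
  · simpa [← toOp_add, hW] using hS
  · rw [successProbability_toOp]
    have h := abs_sqrt_sub_le
    norm_num1 at h
    refine hc _ _ ?_ ?_
    · norm_num1; exact h.1
    · norm_num1; exact h.2

lemma isNormalized_toOp {W : InvariantOp} (hW : W.BlockNonneg)
    (ht : ∑ i₁, ∑ o₁, ∑ i₂, ∑ o₂, W.diag i₁ o₁ i₂ o₂ = 4) : IsNormalized W.toOp :=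
  ⟨hW.posSemidef, by rw [trace_toOp, ht]; norm_num⟩

/-! ### Rational primal and dual certificates. -/

open InvariantOp

/-- A dual certificate for parallel strategies. -/
noncomputable def parDual : InvariantOp where
  diag := ![![![![0.809842, 0.000111], ![0.442857, 0.343132]],
      ![![0.000111, 0.000111], ![0.012093, 0.012093]]],
    ![![![0.442857, 0.012093], ![0.378451, 0.116551]],
      ![![0.343132, 0.012093], ![0.116551, 0.198622]]]]
  c₁ := ![![0.467347, 0], ![0.146846, 0.248366]]
  c₂ := ![![0.467347, 0], ![0.146846, 0.248366]]
  g := 0.307719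
  h := 0.331039

lemma parDual_dominates : Dominates parDual := by
  norm_num [Dominates, MinorsPos, MinorsPos₄, MinorsPos₃, dampingMajorant, parDual]

/-- The first element of a parallel tester. -/
noncomputable def parTester : InvariantOp where
  diag := ![![![![0.000565, 0.009152], ![0.000008, 0.000165]],
      ![![0.009152, 0.009152], ![0.000165, 0.000165]]],
    ![![![0.000008, 0.000165], ![0.000006, 0.980993]],
      ![![0.000165, 0.000165], ![0.980993, 0.95151]]]]
  c₁ := ![![-0.000032, 0], ![-0.000054, 0.000236]]
  c₂ := ![![-0.000032, 0], ![-0.000054, 0.000236]]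
  g := 0.022702
  h := 0

/-- A parallel process. -/
noncomputable def parProcess : InvariantOp where
  diag := ![![![![0.018305, 0.018305], ![0.00033, 0.00033]],
      ![![0.018305, 0.018305], ![0.00033, 0.00033]]],
    ![![![0.00033, 0.00033], ![0.981035, 0.981035]],
      ![![0.00033, 0.00033], ![0.981035, 0.981035]]]]
  c₁ := ![![0, 0], ![0, 0]]
  c₂ := ![![0, 0], ![0, 0]]
  g := 0
  h := 0

lemma parTester_minorsPos : parTester.MinorsPos := by
  norm_num [MinorsPos, MinorsPos₄, MinorsPos₃, parTester]

lemma parProcess_sub_minorsPos : (parProcess - parTester).MinorsPos := by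
  norm_num [MinorsPos, MinorsPos₄, MinorsPos₃, parProcess, parTester]

lemma lt_value_par {s t : ℝ} (hs : |s - 793725393319 / 10 ^ 12| ≤ 1 / 10 ^ 12)
    (ht : |t - 360555127546 / 10 ^ 12| ≤ 1 / 10 ^ 12) :
    8101 / 10000 <
      value parTester (parProcess - parTester) s t := by
  obtain ⟨hs₁, hs₂⟩ := abs_le.mp hs
  obtain ⟨ht₁, ht₂⟩ := abs_le.mp ht
  simp [value, parProcess, parTester]
  linarith

/-- A dual certificate for sequential strategies. -/
noncomputable def seqDual : InvariantOp where
  diag := ![![![![0.776971, 0.038511], ![0.457029, 0.358453]],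
      ![![0.000351, 0.000351], ![0.000351, 0.000351]]],
    ![![![0.45706, 0.037942], ![0.378451, 0.116551]],
      ![![0.319896, 0.001286], ![0.117619, 0.203563]]]]
  c₁ := ![![0.419191, -0.007016], ![0.163885, 0.24829]]
  c₂ := ![![0.426206, 0], ![0.146841, 0.245793]]
  g := 0.280627
  h := 0.31861

lemma seqDual_dominates : Dominates seqDual := by
  norm_num [Dominates, MinorsPos, MinorsPos₄, MinorsPos₃, dampingMajorant, seqDual]

/-- The first element of a sequential tester. -/
noncomputable def seqTester : InvariantOp where
  diag := ![![![![0.003567, 0.004283], ![0.002908, 0.001734]],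
      ![![0.002892, 0.002892], ![0.002892, 0.002892]]],
    ![![![0.000007, 0.000053], ![0.000006, 0.98829]],
      ![![0.10573, 0.126197], ![0.736004, 0.42872]]]]
  c₁ := ![![0.019278, 0.023106], ![-0.046201, -0.026864]]
  c₂ := ![![-0.00245, 0], ![-0.000016, 0.212246]]
  g := 0.039041
  h := -0.01332

/-- A sequential process. -/
noncomputable def seqProcess : InvariantOp where
  diag := ![![![![0.008566, 0.008566], ![0.003003, 0.003003]],
      ![![0.005785, 0.005785], ![0.005784, 0.005784]]],
    ![![![0.000105, 0.000105], ![0.988326, 0.988326]],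
      ![![0.252393, 0.252393], ![0.736038, 0.736038]]]]
  c₁ := ![![0.046212, 0.046212], ![-0.046212, -0.046212]]
  c₂ := ![![0, 0], ![0, 0]]
  g := 0
  h := 0

lemma seqTester_minorsPos : seqTester.MinorsPos := by
  norm_num [MinorsPos, MinorsPos₄, MinorsPos₃, seqTester]

lemma seqProcess_sub_minorsPos : (seqProcess - seqTester).MinorsPos := by
  norm_num [MinorsPos, MinorsPos₄, MinorsPos₃, seqProcess, seqTester]

lemma lt_value_seq {s t : ℝ} (hs : |s - 793725393319 / 10 ^ 12| ≤ 1 / 10 ^ 12)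
    (ht : |t - 360555127546 / 10 ^ 12| ≤ 1 / 10 ^ 12) :
    8161 / 10000 <
      value seqTester (seqProcess - seqTester) s t := by
  obtain ⟨hs₁, hs₂⟩ := abs_le.mp hs
  obtain ⟨ht₁, ht₂⟩ := abs_le.mp ht
  simp [value, seqProcess, seqTester]
  linarith

/-- A dual certificate for separable strategies. -/
noncomputable def sepDual : InvariantOp where
  diag := ![![![![0.7737778, 0.00000939], ![0.43510136, 0.31959968]],
      ![![0.00000939, 0.00000485], ![0.00001227, 0.00000068]]],
    ![![![0.43510136, 0.00001227], ![0.37845002, 0.11679087]],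
      ![![0.31959968, 0.00000068], ![0.11679087, 0.20428739]]]]
  c₁ := ![![0.41400291, -0.00000188], ![0.15460044, 0.24608111]]
  c₂ := ![![0.41400291, -0.00000188], ![0.15460044, 0.24608111]]
  g := 0.27759326
  h := 0.31959937

lemma sepDual_dominates : Dominates sepDual := by
  norm_num [Dominates, MinorsPos, MinorsPos₄, MinorsPos₃, dampingMajorant, sepDual]

/-- An upper bound for `sepDual` with a constant value on sequential processes. -/
noncomputable def seqMajorant : InvariantOp where
  diag := ![![![![0.79519918, 0.02143078], ![0.46606582, 0.35056414]],
      ![![0.00001182, 0.00000727], ![0.00001534, 0.00000375]]],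
    ![![![0.46516502, 0.03007592], ![0.37845005, 0.11679089]],
      ![![0.32050355, 0.00090456], ![0.1169558, 0.20445231]]]]
  c₁ := ![![0.40960283, -0.00440196], ![0.1568601, 0.24834077]]
  c₂ := ![![0.41400291, -0.00000188], ![0.15460044, 0.24608111]]
  g := 0.27759326
  h := 0.31959937

/-- `seqMajorant` with the two slots exchanged. -/
noncomputable def seqMajorant' : InvariantOp where
  diag := ![![![![0.79519918, 0.00001182], ![0.46516502, 0.32050355]],
      ![![0.02143078, 0.00000727], ![0.03007592, 0.00090456]]],
    ![![![0.46606582, 0.00001534], ![0.37845005, 0.1169558]],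
      ![![0.35056414, 0.00000375], ![0.11679089, 0.20445231]]]]
  c₁ := ![![0.41400291, -0.00000188], ![0.15460044, 0.24608111]]
  c₂ := ![![0.40960283, -0.00440196], ![0.1568601, 0.24834077]]
  g := 0.27759326
  h := 0.31959937

lemma seqMajorant_sub_sepDual : (seqMajorant - sepDual).MinorsPos := by
  norm_num [MinorsPos, MinorsPos₄, MinorsPos₃, seqMajorant, sepDual]

lemma seqMajorant'_sub_sepDual : (seqMajorant' - sepDual).MinorsPos := by
  norm_num [MinorsPos, MinorsPos₄, MinorsPos₃, seqMajorant', sepDual]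

/-- The first element of a separable tester. -/
noncomputable def sepTester : InvariantOp where
  diag := ![![![![0.004901, 0.004922], ![0.000846, 0.05367]],
      ![![0.004922, 0.004245], ![0.001694, 0.066051]]],
    ![![![0.000846, 0.001694], ![0.000006, 0.855983]],
      ![![0.05367, 0.066051], ![0.855983, 0.408335]]]]
  c₁ := ![![0.010079, 0.013367], ![-0.026776, 0.092247]]
  c₂ := ![![0.010079, 0.013367], ![-0.026776, 0.092247]]
  g := 0.044693
  h := -0.011704

/-- The part of the separable process `sepProcess` with slot `1` before slot `2`. -/
noncomputable def sepOrdered : InvariantOp where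
  diag := ![![![![0.011198, 0.011198], ![0.003999, 0.003999]],
      ![![0.00849, 0.00849], ![0.006707, 0.006707]]],
    ![![![0.00007, 0.00007], ![0.984733, 0.984733]],
      ![![0.257499, 0.257499], ![0.727304, 0.727304]]]]
  c₁ := ![![0.053469, 0.053469], ![-0.053469, -0.053469]]
  c₂ := ![![0, 0], ![0, 0]]
  g := 0
  h := 0

/-- The part of the separable process `sepProcess` with slot `2` before slot `1`. -/
noncomputable def sepOrdered' : InvariantOp where
  diag := ![![![![0.011198, 0.00849], ![0.00007, 0.257499]],
      ![![0.011198, 0.00849], ![0.00007, 0.257499]]],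
    ![![![0.003999, 0.006707], ![0.984733, 0.727304]],
      ![![0.003999, 0.006707], ![0.984733, 0.727304]]]]
  c₁ := ![![0, 0], ![0, 0]]
  c₂ := ![![0.053469, 0.053469], ![-0.053469, -0.053469]]
  g := 0
  h := 0

/-- A separable process. -/
noncomputable def sepProcess : InvariantOp where
  diag := ![![![![0.011198, 0.009844], ![0.0020345, 0.130749]],
      ![![0.009844, 0.00849], ![0.0033885, 0.132103]]],
    ![![![0.0020345, 0.0033885], ![0.984733, 0.8560185]],
      ![![0.130749, 0.132103], ![0.8560185, 0.727304]]]]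
  c₁ := ![![0.0267345, 0.0267345], ![-0.0267345, -0.0267345]]
  c₂ := ![![0.0267345, 0.0267345], ![-0.0267345, -0.0267345]]
  g := 0
  h := 0

lemma sepOrdered_minorsPos : sepOrdered.MinorsPos := by
  norm_num [MinorsPos, MinorsPos₄, MinorsPos₃, sepOrdered]

lemma sepOrdered'_minorsPos : sepOrdered'.MinorsPos := by
  norm_num [MinorsPos, MinorsPos₄, MinorsPos₃, sepOrdered']

lemma sepTester_minorsPos : sepTester.MinorsPos := by
  norm_num [MinorsPos, MinorsPos₄, MinorsPos₃, sepTester]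

lemma sepProcess_sub_minorsPos : (sepProcess - sepTester).MinorsPos := by
  norm_num [MinorsPos, MinorsPos₄, MinorsPos₃, sepProcess, sepTester]

lemma lt_value_sep {s t : ℝ} (hs : |s - 793725393319 / 10 ^ 12| ≤ 1 / 10 ^ 12)
    (ht : |t - 360555127546 / 10 ^ 12| ≤ 1 / 10 ^ 12) :
    8166 / 10000 <
      value sepTester (sepProcess - sepTester) s t := by
  obtain ⟨hs₁, hs₂⟩ := abs_le.mp hs
  obtain ⟨ht₁, ht₂⟩ := abs_le.mp ht
  simp [value, sepProcess, sepTester]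
  linarith

/-- A dual certificate for general strategies. -/
noncomputable def genDual : InvariantOp where
  diag := ![![![![0.816181, 0.000245], ![0.494969, 0.321457]],
      ![![0.000245, 0.000128], ![0.000355, 0.000018]]],
    ![![![0.494969, 0.000355], ![0.378451, 0.116873]],
      ![![0.321457, 0.000018], ![0.116873, 0.204602]]]]
  c₁ := ![![0.403203, -0.00005], ![0.156838, 0.246315]]
  c₂ := ![![0.403203, -0.00005], ![0.156838, 0.246315]]
  g := 0.27606
  h := 0.32145

lemma genDual_dominates : Dominates genDual := by
  norm_num [Dominates, MinorsPos, MinorsPos₄, MinorsPos₃, dampingMajorant, genDual]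

/-- The first element of a general tester. -/
noncomputable def genTester : InvariantOp where
  diag := ![![![![0.00526, 0.00493], ![0.0009, 0.05455]],
      ![![0.00493, 0.00397], ![0.00143, 0.0672]]],
    ![![![0.0009, 0.00143], ![0.00001, 0.85477]],
      ![![0.05455, 0.0672], ![0.85477, 0.40083]]]]
  c₁ := ![![0.01058, 0.01384], ![-0.02767, 0.09251]]
  c₂ := ![![0.01058, 0.01384], ![-0.02767, 0.09251]]
  g := 0.04587
  h := -0.01169

/-- A general process. -/
noncomputable def genProcess : InvariantOp where
  diag := ![![![![0.01179, 0.00986], ![0.00094, 0.13247]],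
      ![![0.00986, 0.00793], ![0.00287, 0.1344]]],
    ![![![0.00094, 0.00287], ![0.98633, 0.8548]],
      ![![0.13247, 0.1344], ![0.8548, 0.72327]]]]
  c₁ := ![![0.02767, 0.02767], ![-0.02767, -0.02767]]
  c₂ := ![![0.02767, 0.02767], ![-0.02767, -0.02767]]
  g := 0
  h := 0

lemma genTester_minorsPos : genTester.MinorsPos := by
  norm_num [MinorsPos, MinorsPos₄, MinorsPos₃, genTester]

lemma genProcess_sub_minorsPos : (genProcess - genTester).MinorsPos := by
  norm_num [MinorsPos, MinorsPos₄, MinorsPos₃, genProcess, genTester]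

lemma lt_value_gen {s t : ℝ} (hs : |s - 793725393319 / 10 ^ 12| ≤ 1 / 10 ^ 12)
    (ht : |t - 360555127546 / 10 ^ 12| ≤ 1 / 10 ^ 12) :
    8167 / 10000 <
      value genTester (genProcess - genTester) s t := by
  obtain ⟨hs₁, hs₂⟩ := abs_le.mp hs
  obtain ⟨ht₁, ht₂⟩ := abs_le.mp ht
  simp [value, genProcess, genTester]
  linarith

/-! ### Verification of the linear constraints. -/

namespace InvariantOp

lemma eq_iff_entries {X Y : InvariantOp} : X = Y ↔
    (∀ i₁ o₁ i₂ o₂, X.diag i₁ o₁ i₂ o₂ = Y.diag i₁ o₁ i₂ o₂) ∧ (∀ i o, X.c₁ i o = Y.c₁ i o) ∧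
      (∀ i o, X.c₂ i o = Y.c₂ i o) ∧ X.g = Y.g ∧ X.h = Y.h := by
  simp [InvariantOp.ext_iff, funext_iff]

lemma add_sub_cancel' (X Y : InvariantOp) : X + (Y - X) = Y := by
  simp [eq_iff_entries]

lemma MinorsPos.blockNonneg_of_sub {X Y : InvariantOp} (hX : X.MinorsPos)
    (hY : (Y - X).MinorsPos) : Y.BlockNonneg :=
  add_sub_cancel' X Y ▸ hX.blockNonneg.add hY.blockNonneg

end InvariantOp

open InvariantOp

lemma parProcess_isParallelProcess : IsParallelProcess parProcess.toOp := by
  refine ⟨isNormalized_toOp (parTester_minorsPos.blockNonneg_of_sub parProcess_sub_minorsPos)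
    (by norm_num [Fin.sum_univ_two, parProcess]), ?_⟩
  rw [replO₂_toOp, replO₁_toOp]
  congr 1
  rw [eq_iff_entries]
  norm_num [Fin.forall_fin_two, InvariantOp.replO₁, InvariantOp.replO₂, parProcess]

lemma seqProcess_isSequentialProcess : IsSequentialProcess seqProcess.toOp := by
  refine ⟨isNormalized_toOp (seqTester_minorsPos.blockNonneg_of_sub seqProcess_sub_minorsPos)
    (by norm_num [Fin.sum_univ_two, seqProcess]), ?_, ?_⟩
    <;> simp only [replO₂_toOp, replO₁_toOp, replI₂_toOp] <;> congr 1
    <;> rw [eq_iff_entries]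
    <;> norm_num [Fin.forall_fin_two, InvariantOp.replO₁, InvariantOp.replI₂, InvariantOp.replO₂,
      seqProcess]

lemma sepOrdered_isSequentialProcess : IsSequentialProcess sepOrdered.toOp := by
  refine ⟨isNormalized_toOp sepOrdered_minorsPos.blockNonneg
    (by norm_num [Fin.sum_univ_two, sepOrdered]), ?_, ?_⟩
    <;> simp only [replO₂_toOp, replO₁_toOp, replI₂_toOp] <;> congr 1
    <;> rw [eq_iff_entries]
    <;> norm_num [Fin.forall_fin_two, InvariantOp.replO₁, InvariantOp.replI₂, InvariantOp.replO₂,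
      sepOrdered]

lemma sepOrdered'_isSequentialProcess' : IsSequentialProcess' sepOrdered'.toOp := by
  refine ⟨isNormalized_toOp sepOrdered'_minorsPos.blockNonneg
    (by norm_num [Fin.sum_univ_two, sepOrdered']), ?_, ?_⟩
    <;> simp only [replO₂_toOp, replO₁_toOp, replI₁_toOp] <;> congr 1
    <;> rw [eq_iff_entries]
    <;> norm_num [Fin.forall_fin_two, InvariantOp.replO₁, InvariantOp.replI₁, InvariantOp.replO₂,
      sepOrdered']

lemma sepProcess_isSeparableProcess : IsSeparableProcess sepProcess.toOp := by
  refine ⟨isNormalized_toOp (sepTester_minorsPos.blockNonneg_of_sub sepProcess_sub_minorsPos)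
    (by norm_num [Fin.sum_univ_two, sepProcess]),
    -- The two orders get equal weight: `sepOrdered'` is `sepOrdered` with the slots exchanged.
    1 / 2, _, _, by norm_num, by norm_num, sepOrdered_isSequentialProcess,
    sepOrdered'_isSequentialProcess', ?_⟩
  rw [← toOp_smul, ← toOp_smul, ← toOp_add]
  congr 1
  rw [eq_iff_entries]
  norm_num [Fin.forall_fin_two, sepOrdered, sepOrdered', sepProcess]

lemma genProcess_isGeneralProcess : IsGeneralProcess genProcess.toOp := by
  refine ⟨isNormalized_toOp (genTester_minorsPos.blockNonneg_of_sub genProcess_sub_minorsPos)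
    (by norm_num [Fin.sum_univ_two, genProcess]), ?_, ?_, ?_⟩
    <;> simp only [replO₂_toOp, replO₁_toOp, replI₁_toOp, replI₂_toOp, ← toOp_add, ← toOp_sub]
    <;> congr 1 <;> rw [eq_iff_entries]
    <;> norm_num [Fin.forall_fin_two, InvariantOp.replI₁, InvariantOp.replO₁, InvariantOp.replI₂,
      InvariantOp.replO₂, genProcess]

lemma IsParallelProcess.trace_mul_parDual {W : Op (Fin 2) (Fin 2) (Fin 2) (Fin 2)}
    (hW : IsParallelProcess W) : (W * parDual.toOp).trace.re = 0.810175 := by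
  -- Here `c` is the bound divided by `d_{O₁} d_{O₂} = 4`, as in the similar lemmas below.
  rw [hW.trace_mul (c := ((0.20254375 : ℝ) : ℂ))]
  · norm_num
  · simp only [replO₂_toOp, replO₁_toOp,
      ← toOp_one, ← toOp_smul]
    congr 1
    rw [eq_iff_entries]
    norm_num [Fin.forall_fin_two, InvariantOp.replI₁, InvariantOp.replO₁, InvariantOp.replI₂,
      InvariantOp.replO₂, parDual]

lemma IsSequentialProcess.trace_mul_seqDual {W : Op (Fin 2) (Fin 2) (Fin 2) (Fin 2)}
    (hW : IsSequentialProcess W) : (W * seqDual.toOp).trace.re = 0.816184 := by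
  rw [hW.trace_mul (c := ((0.204046 : ℝ) : ℂ))]
  · norm_num
  · simp only [replO₂_toOp, replO₁_toOp, replI₂_toOp, ← toOp_add, ← toOp_sub,
      ← toOp_one, ← toOp_smul]
    congr 1
    rw [eq_iff_entries]
    norm_num [Fin.forall_fin_two, InvariantOp.replI₁, InvariantOp.replO₁, InvariantOp.replI₂,
      InvariantOp.replO₂, seqDual]

lemma IsSequentialProcess.trace_mul_seqMajorant {W : Op (Fin 2) (Fin 2) (Fin 2) (Fin 2)}
    (hW : IsSequentialProcess W) : (W * seqMajorant.toOp).trace.re = 0.81664905 := by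
  rw [hW.trace_mul (c := ((0.2041622625 : ℝ) : ℂ))]
  · norm_num
  · simp only [replO₂_toOp, replO₁_toOp, replI₂_toOp, ← toOp_add, ← toOp_sub,
      ← toOp_one, ← toOp_smul]
    congr 1
    rw [eq_iff_entries]
    norm_num [Fin.forall_fin_two, InvariantOp.replI₁, InvariantOp.replO₁, InvariantOp.replI₂,
      InvariantOp.replO₂, seqMajorant]

lemma IsSequentialProcess'.trace_mul_seqMajorant' {W : Op (Fin 2) (Fin 2) (Fin 2) (Fin 2)}
    (hW : IsSequentialProcess' W) : (W * seqMajorant'.toOp).trace.re = 0.81664905 := by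
  rw [hW.trace_mul (c := ((0.2041622625 : ℝ) : ℂ))]
  · norm_num
  · simp only [replO₂_toOp, replO₁_toOp, replI₁_toOp, ← toOp_add, ← toOp_sub,
      ← toOp_one, ← toOp_smul]
    congr 1
    rw [eq_iff_entries]
    norm_num [Fin.forall_fin_two, InvariantOp.replI₁, InvariantOp.replO₁, InvariantOp.replI₂,
      InvariantOp.replO₂, seqMajorant']

lemma IsGeneralProcess.trace_mul_genDual {W : Op (Fin 2) (Fin 2) (Fin 2) (Fin 2)}
    (hW : IsGeneralProcess W) : (W * genDual.toOp).trace.re = 0.816799 := by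
  rw [hW.trace_mul (c := ((0.20419975 : ℝ) : ℂ))]
  · norm_num
  · simp only [replO₂_toOp, replO₁_toOp, replI₁_toOp, replI₂_toOp, ← toOp_add, ← toOp_sub,
      ← toOp_one, ← toOp_smul]
    congr 1
    rw [eq_iff_entries]
    norm_num [Fin.forall_fin_two, InvariantOp.replI₁, InvariantOp.replO₁, InvariantOp.replI₂,
      InvariantOp.replO₂, genDual]

/-- One dual must serve both orders. Equality is replaced by domination: `seqMajorant` and
`seqMajorant'` lie above `sepDual` and take the same constant value on their respective orders. -/
lemma IsSeparableProcess.trace_mul_sepDual_le {W : Op (Fin 2) (Fin 2) (Fin 2) (Fin 2)}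
    (hW : IsSeparableProcess W) : (W * sepDual.toOp).trace.re ≤ 0.81664905 := by
  obtain ⟨-, q, W₁, W₂, hq₀, hq₁, hW₁, hW₂, rfl⟩ := hW
  have h₁ := trace_mul_re_nonneg hW₁.1.1 seqMajorant_sub_sepDual.blockNonneg.posSemidef
  have h₂ := trace_mul_re_nonneg hW₂.1.1 seqMajorant'_sub_sepDual.blockNonneg.posSemidef
  rw [toOp_sub, Matrix.mul_sub, Matrix.trace_sub, Complex.sub_re] at h₁ h₂
  rw [hW₁.trace_mul_seqMajorant] at h₁
  rw [hW₂.trace_mul_seqMajorant'] at h₂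
  rw [Matrix.add_mul, Matrix.trace_add, Matrix.smul_mul, Matrix.smul_mul, Matrix.trace_smul,
    Matrix.trace_smul, Complex.add_re, smul_eq_mul, smul_eq_mul, Complex.re_ofReal_mul,
    Complex.re_ofReal_mul]
  nlinarith [mul_nonneg hq₀ h₁, mul_nonneg (sub_nonneg.mpr hq₁) h₂]

lemma isGreatest_P_of_mem {S : Strategy} {r : ℝ}
    (h : r ∈ successProbabilities S (fun _ => 1 / 2) twoDampings) :
    IsGreatest (successProbabilities S (fun _ => 1 / 2) twoDampings) (P S) :=
  isGreatest_maxSuccess ⟨r, h⟩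

end ChannelDiscrimination

theorem mainTheorem2 :
    (∀ S : ChannelDiscrimination.Strategy,
      IsGreatest
        (ChannelDiscrimination.successProbabilities S (fun _ => 1 / 2)
          ChannelDiscrimination.twoDampings)
        (ChannelDiscrimination.P S)) ∧
    (ChannelDiscrimination.P .par < ChannelDiscrimination.P .seq ∧
      ChannelDiscrimination.P .seq < ChannelDiscrimination.P .sep ∧
      ChannelDiscrimination.P .sep < ChannelDiscrimination.P .gen) ∧
    (8101 / 10000 < ChannelDiscrimination.P .par ∧
      ChannelDiscrimination.P .par < 8102 / 10000) ∧
    (8161 / 10000 < ChannelDiscrimination.P .seq ∧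
      ChannelDiscrimination.P .seq < 8162 / 10000) ∧
    (8166 / 10000 < ChannelDiscrimination.P .sep ∧
      ChannelDiscrimination.P .sep < 81665 / 100000) ∧
    (8167 / 10000 < ChannelDiscrimination.P .gen ∧
      ChannelDiscrimination.P .gen < 8168 / 10000) := by
  obtain ⟨r₁, hr₁, hlt₁⟩ := ChannelDiscrimination.exists_mem_successProbabilities
    (S := .par) ChannelDiscrimination.parTester_minorsPos
    ChannelDiscrimination.parProcess_sub_minorsPos
    (ChannelDiscrimination.InvariantOp.add_sub_cancel' _ _)
    ChannelDiscrimination.parProcess_isParallelProcess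
    fun _ _ => ChannelDiscrimination.lt_value_par
  obtain ⟨r₂, hr₂, hlt₂⟩ := ChannelDiscrimination.exists_mem_successProbabilities
    (S := .seq) ChannelDiscrimination.seqTester_minorsPos
    ChannelDiscrimination.seqProcess_sub_minorsPos
    (ChannelDiscrimination.InvariantOp.add_sub_cancel' _ _)
    ChannelDiscrimination.seqProcess_isSequentialProcess
    fun _ _ => ChannelDiscrimination.lt_value_seq
  obtain ⟨r₃, hr₃, hlt₃⟩ := ChannelDiscrimination.exists_mem_successProbabilities
    (S := .sep) ChannelDiscrimination.sepTester_minorsPos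
    ChannelDiscrimination.sepProcess_sub_minorsPos
    (ChannelDiscrimination.InvariantOp.add_sub_cancel' _ _)
    ChannelDiscrimination.sepProcess_isSeparableProcess
    fun _ _ => ChannelDiscrimination.lt_value_sep
  obtain ⟨r₄, hr₄, hlt₄⟩ := ChannelDiscrimination.exists_mem_successProbabilities
    (S := .gen) ChannelDiscrimination.genTester_minorsPos
    ChannelDiscrimination.genProcess_sub_minorsPos
    (ChannelDiscrimination.InvariantOp.add_sub_cancel' _ _)
    ChannelDiscrimination.genProcess_isGeneralProcess
    fun _ _ => ChannelDiscrimination.lt_value_gen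
  have g₁ := ChannelDiscrimination.isGreatest_P_of_mem hr₁
  have g₂ := ChannelDiscrimination.isGreatest_P_of_mem hr₂
  have g₃ := ChannelDiscrimination.isGreatest_P_of_mem hr₃
  have g₄ := ChannelDiscrimination.isGreatest_P_of_mem hr₄
  have l₁ := hlt₁.trans_le (g₁.2 hr₁)
  have l₂ := hlt₂.trans_le (g₂.2 hr₂)
  have l₃ := hlt₃.trans_le (g₃.2 hr₃)
  have l₄ := hlt₄.trans_le (g₄.2 hr₄)
  have u₁ := ChannelDiscrimination.parDual_dominates.le_of_mem (S := .par) (fun _ hW =>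
    (ChannelDiscrimination.IsParallelProcess.trace_mul_parDual hW).le) g₁.1
  have u₂ := ChannelDiscrimination.seqDual_dominates.le_of_mem (S := .seq) (fun _ hW =>
    (ChannelDiscrimination.IsSequentialProcess.trace_mul_seqDual hW).le) g₂.1
  have u₃ := ChannelDiscrimination.sepDual_dominates.le_of_mem (S := .sep) (fun _ hW =>
    ChannelDiscrimination.IsSeparableProcess.trace_mul_sepDual_le hW) g₃.1
  have u₄ := ChannelDiscrimination.genDual_dominates.le_of_mem (S := .gen) (fun _ hW =>
    (ChannelDiscrimination.IsGeneralProcess.trace_mul_genDual hW).le) g₄.1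
  refine ⟨fun S => ?_, ⟨?_, ?_, ?_⟩, ⟨l₁, ?_⟩, ⟨l₂, ?_⟩, ⟨l₃, ?_⟩, ⟨l₄, ?_⟩⟩
  · cases S <;> assumption
  -- Each upper bound lies below the next class's lower bound, so the numerical enclosures also
  -- yield the strict order.
  all_goals linarith
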